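/- **Theorem.** Let $\psi(k)$, $k\ge 1$, be a sequence of positive numbers with $\lim_{k\to\infty}\psi(k+1)/\psi(k)=0$, and let $\beta_k\in\mathbb R$, $k\ge1$. *Notation.* $C$ and $L_\infty$ are the spaces of $2\pi$-periodic real functions that are continuous, respectively measurable and essentially bounded, with the norms $\|g\|_C=\max_t|g(t)|$ and $\|g\|_{L_\infty}=\operatorname{ess\,sup}_t|g(t)|$. For an integrable $2\pi$-periodic function $f$ with Fourier coefficients $a_k,b_k$, the $(\psi,\bar\beta)$-derivative $f^\psi_{\bar\beta}$ is the integrable $2\pi$-periodic function (if there is one) whose Fourier series is $$\sum_{k=1}^\infty\frac1{\psi(k)}\Bigl(a_k\cos\bigl(kx+\tfrac{\beta_k\pi}2\bigr)+b_k\sin\bigl(kx+\tfrac{\beta_k\pi}2\bigr)\Bigr).$$ $C^\psi_{\bar\beta}L_\infty$ and $C^\psi_{\bar\beta}C$ are the sets of those $f\in C$ which have such a derivative in $L_\infty$, respectively in $C$. For $X=C$ or $X=L_\infty$, $E_m(g)_X$ is the infimum of $\|g-t\|_X$ over the real trigonometric polynomials $t$ of order at most $m-1$. For natural numbers $1\le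 p\le n$ put $$\rho_{n,p}(f;x)=f(x)-\frac1p\sum_{k=n-p}^{n-1}S_k(f;x),$$ where $S_k(f;x)$ is the partial Fourier sum of order $k$ of $f$, and put $$\tau_{n,p}(k)=\begin{cases}1-\frac{n-k}{p},& n-p+1\le k\le n-1,\\ 1,& k\ge n,\end{cases}$$ $$R_{n,p}=\frac{\psi^2(n-p+2)}{\psi(n-p+1)}+p\sum_{k=n-p+3}^\infty\psi(k)\,\tau_{n,p}(k).$$ *Claim.* There is an absolute constant $K$ (independent of $\psi,\bar\beta,n,p,f$) such that for all $\psi,\bar\beta$ as above, all natural $1\le p\le n$ and all $f\in C^\psi_{\bar\beta}L_\infty$: 1. $$\|\rho_{n,p}(f)\|_C\le\frac1p\Bigl(\frac4\pi\psi(n-p+1)+K\,R_{n,p}\Bigr)E_{n-p+1}(f^\psi_{\bar\beta})_{L_\infty}.$$ 2. There is a function $F=F(f;n;p;\cdot)\in C^\psi_{\bar\beta}C$ with $E_{n-p+1}(F^\psi_{\bar\beta})_C=E_{n-p+1}(f^\psi_{\bar\beta})_{L_\infty}$ and a number $\theta$ with $|\theta|\le K$ such that $$\|\rho_{n,p}(F)\|_C=\frac1p\Bigl(\frac4\pi\psi(n-p+1)+\theta\,R_{n,p}\Bigr)E_{n-p+1}(F^\psi_{\bar\beta})_C.$$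 In particular this equality holds, with $\theta=O(1)$ uniformly in all parameters, as $n-p\to\infty$. -/

import Mathlib

open scoped Real ENNReal Topology

namespace VP

noncomputable section

/-- Membership in the class `D₀`, for a sequence `ψ(k)`, `k ≥ 1` (the value `ψ 0` is never used):
`ψ(k) > 0` and `ψ(k+1)/ψ(k) → 0`. -/
def IsD0 (ψ : ℕ → ℝ) : Prop :=
  (∀ k : ℕ, 1 ≤ k → 0 < ψ k) ∧
    Filter.Tendsto (fun k : ℕ => ψ (k + 1) / ψ k) Filter.atTop (𝓝 0)

/-- Lebesgue measure on one period. -/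
def periodMeasure : MeasureTheory.Measure ℝ :=
  MeasureTheory.volume.restrict (Set.Ioc (-π) π)

/-- The space `L_s` of `2π`-periodic functions (through representatives). -/
def spaceL (s : ℝ≥0∞) : Set (ℝ → ℝ) :=
  {f | Function.Periodic f (2 * π) ∧ MeasureTheory.MemLp f s periodMeasure}

/-- The norm of `L_s`; for `s = ∞` the essential supremum of `|f|`. -/
def normL (s : ℝ≥0∞) (f : ℝ → ℝ) : ℝ :=
  (MeasureTheory.eLpNorm f s periodMeasure).toReal

/-- The space `C` of continuous `2π`-periodic functions. -/
def spaceC : Set (ℝ → ℝ) :=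
  {f | Function.Periodic f (2 * π) ∧ Continuous f}

/-- The norm of `C`. -/
def normC (f : ℝ → ℝ) : ℝ := ⨆ x : ℝ, |f x|

/-- The Fourier coefficient `a_k(f)`. -/
def fourierA (f : ℝ → ℝ) (k : ℕ) : ℝ :=
  (1 / π) * ∫ t in (-π)..π, f t * Real.cos (k * t)

/-- The Fourier coefficient `b_k(f)`. -/
def fourierB (f : ℝ → ℝ) (k : ℕ) : ℝ :=
  (1 / π) * ∫ t in (-π)..π, f t * Real.sin (k * t)

/-- `φ` is (a representative of) the `(ψ, β)`-derivative of `f`: both are in `L_1`, and the Fourier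
series of `φ` is
`∑_{k ≥ 1} (1/ψ(k)) (a_k(f) cos (kx + β_k π/2) + b_k(f) sin (kx + β_k π/2))`,
with no constant term. Two trigonometric series are the same iff their terms of each frequency
agree as functions of `x`. -/
def IsPsiBetaDeriv (ψ β : ℕ → ℝ) (f φ : ℝ → ℝ) : Prop :=
  f ∈ spaceL 1 ∧ φ ∈ spaceL 1 ∧ fourierA φ 0 = 0 ∧
    ∀ k : ℕ, 1 ≤ k → ∀ x : ℝ,
      fourierA φ k * Real.cos (k * x) + fourierB φ k * Real.sin (k * x) =
        (1 / ψ k) * (fourierA f k * Real.cos (k * x + β k * π / 2) +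
          fourierB f k * Real.sin (k * x + β k * π / 2))

/-- The class `C^ψ_β 𝔑` of continuous functions that have a `(ψ, β)`-derivative in `𝔑`. -/
def classC (ψ β : ℕ → ℝ) (𝔑 : Set (ℝ → ℝ)) : Set (ℝ → ℝ) :=
  {f | f ∈ spaceC ∧ ∃ φ ∈ 𝔑, IsPsiBetaDeriv ψ β f φ}

/-- Trigonometric polynomials of order at most `m - 1` (for `m ≥ 1`). -/
def trigPoly (m : ℕ) : Set (ℝ → ℝ) :=
  {t | ∃ α γ : ℕ → ℝ,
    t = fun x => ∑ k ∈ Finset.range m, (α k * Real.cos (k * x) + γ k * Real.sin (k * x))}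

/-- The best approximation `E_m(g)_C`. -/
def bestC (m : ℕ) (g : ℝ → ℝ) : ℝ :=
  ⨅ t : trigPoly m, normC (fun x => g x - (t : ℝ → ℝ) x)

/-- The best approximation `E_m(g)_{L_s}`. -/
def bestL (s : ℝ≥0∞) (m : ℕ) (g : ℝ → ℝ) : ℝ :=
  ⨅ t : trigPoly m, normL s (fun x => g x - (t : ℝ → ℝ) x)

/-- The partial Fourier sum `S_k(f; x)`. -/
def fourierSum (k : ℕ) (f : ℝ → ℝ) (x : ℝ) : ℝ :=
  fourierA f 0 / 2 +
    ∑ j ∈ Finset.Icc 1 k, (fourierA f j * Real.cos (j * x) + fourierB f j * Real.sin (j * x))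

/-- The de la Vallée Poussin sum `V_{n,p}(f; x)`, the mean of `S_{n-p}, …, S_{n-1}` (`1 ≤ p ≤ n`). -/
def vallee (n p : ℕ) (f : ℝ → ℝ) (x : ℝ) : ℝ :=
  (1 / (p : ℝ)) * ∑ k ∈ Finset.Ico (n - p) n, fourierSum k f x

/-- The deviation `ρ_{n,p}(f; x)`. -/
def rho (n p : ℕ) (f : ℝ → ℝ) (x : ℝ) : ℝ := f x - vallee n p f x

/-- The coefficients `τ_{n,p}(k)`, `k ≥ n - p + 1`. -/
def tau (n p k : ℕ) : ℝ :=
  if k < n then 1 - ((n : ℝ) - (k : ℝ)) / (p : ℝ) else 1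

/-- The quantity `ψ²(n-p+2)/ψ(n-p+1) + p ∑_{k ≥ n-p+3} ψ(k) τ_{n,p}(k)`. -/
def remainder (ψ : ℕ → ℝ) (n p : ℕ) : ℝ :=
  ψ (n - p + 2) ^ 2 / ψ (n - p + 1) +
    (p : ℝ) * ∑' j : ℕ, ψ (n - p + 3 + j) * tau n p (n - p + 3 + j)

end

end VP

/-! Put `q = n - p`. Averaging the remainders of the partial sums gives `p * rho` as the harmonic of
`f` of frequency `q + 1`, plus `min 2 p` times that of frequency `q + 2`, plus a tail
(`hasSum_rho`). Each harmonic of `f` is a translate of `ψ k` times the harmonic of `φ`. For `k > q`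
the latter does not change when a polynomial `T` of order at most `q` is subtracted from `φ`, so a
bound `M` on `|φ - T|` makes the tail at most `2 * M * tailSum` (`abs_rho_sub_le`).

The two leading harmonics form a convolution of `φ - T` with `a cos(m(y - t)) + b cos((m + 1)(z -
t))`, `m = q + 1`. The triangle inequality for its `L_1` norm would leave an error of order `b`; the
claim needs `b²/a`. A translation by `π` reverses the relative sign of the two cosines, so the norm
is the mean of those of `A + B` and `A - B`, that is, the integral of `max |A| |B|`. This exceeds
the integral of `|A|` by at most a multiple of `b²/a`: the excess is at most `b`, on a set of
measure `O(b/a)` (`integral_abs_two_cos_le`).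

For sharpness, `Φ` is a steep continuous version of `E * sign (cos (m t))`. It alternates at `2m`
points, so its best approximation is exactly `E` (`bestC_clippedCos`), while its `m`-th cosine
coefficient is nearly `4E/π` (`le_fourierA_clippedCos`). The same translation by `π` keeps the
second harmonic from lowering the maximum (`le_normC_rho`). -/

namespace VP

open MeasureTheory (volume)
open intervalIntegral

/-! ### Harmonics as convolutions; orthogonality -/

/-- The harmonic of frequency `k` of the Fourier series of `f`. -/
noncomputable def harmonic (f : ℝ → ℝ) (k : ℕ) (x : ℝ) : ℝ :=
  fourierA f k * Real.cos (k * x) + fourierB f k * Real.sin (k * x)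

theorem harmonic_eq_integral {f : ℝ → ℝ} (hf : IntervalIntegrable f volume (-π) π) (k : ℕ)
    (x : ℝ) : harmonic f k x = (1 / π) * ∫ t in (-π)..π, f t * Real.cos (k * (x - t)) := by
  have h1 : IntervalIntegrable (fun t => f t * Real.cos (k * t)) volume (-π) π :=
    hf.mul_continuousOn (by fun_prop)
  have h2 : IntervalIntegrable (fun t => f t * Real.sin (k * t)) volume (-π) π :=
    hf.mul_continuousOn (by fun_prop)
  have h : ∫ t in (-π)..π, f t * Real.cos (k * (x - t)) =
      (∫ t in (-π)..π, f t * Real.cos (k * t)) * Real.cos (k * x) +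
      (∫ t in (-π)..π, f t * Real.sin (k * t)) * Real.sin (k * x) := by
    rw [← integral_mul_const, ← integral_mul_const,
      ← integral_add (h1.mul_const _) (h2.mul_const _)]
    congr 1
    ext t
    rw [mul_sub, Real.cos_sub]
    ring
  rw [h, harmonic, fourierA, fourierB]
  ring

theorem integral_cos_int_mul_add {a : ℤ} (ha : a ≠ 0) (c : ℝ) :
    ∫ t in (-π)..π, Real.cos (a * t + c) = 0 := by
  have ha' : (a : ℝ) ≠ 0 := by exact_mod_cast ha
  rw [intervalIntegral.integral_comp_mul_add (fun u => Real.cos u) ha', integral_cos,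
    show (a : ℝ) * π + c = (a * -π + c) + a * (2 * π) by ring, Real.sin_add_int_mul_two_pi,
    sub_self, smul_zero]

theorem integral_cos_mul_cos {j k : ℕ} (h : j ≠ k) (c d : ℝ) :
    ∫ t in (-π)..π, Real.cos (j * t + c) * Real.cos (k * t + d) = 0 := by
  have key : ∀ t : ℝ, Real.cos (j * t + c) * Real.cos (k * t + d) =
      (Real.cos (((j : ℤ) + k : ℤ) * t + (c + d)) +
        Real.cos (((j : ℤ) - k : ℤ) * t + (c - d))) / 2 := by
    intro t
    push_cast
    rw [show ((j : ℝ) + k) * t + (c + d) = (j * t + c) + (k * t + d) by ring,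
      show ((j : ℝ) - k) * t + (c - d) = (j * t + c) - (k * t + d) by ring,
      Real.cos_add (j * t + c), Real.cos_sub (j * t + c)]
    ring
  simp_rw [key]
  rw [intervalIntegral.integral_div, integral_add, integral_cos_int_mul_add (by omega),
    integral_cos_int_mul_add (by omega)]
  · simp
  all_goals exact Continuous.intervalIntegrable (by fun_prop) _ _

theorem continuous_of_mem_trigPoly {m : ℕ} {T : ℝ → ℝ} (hT : T ∈ trigPoly m) : Continuous T := by
  obtain ⟨α, γ, rfl⟩ := hT
  fun_prop

theorem periodic_of_mem_trigPoly {m : ℕ} {T : ℝ → ℝ} (hT : T ∈ trigPoly m) :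
    Function.Periodic T (2 * π) := by
  obtain ⟨α, γ, rfl⟩ := hT
  intro x
  simp only [mul_add, Real.cos_add_nat_mul_two_pi, Real.sin_add_nat_mul_two_pi]

theorem integral_harmonic_mul_cos_of_ne {j k : ℕ} (hjk : j ≠ k) (u v x : ℝ) :
    ∫ t in (-π)..π, (u * Real.cos (j * t) + v * Real.sin (j * t)) * Real.cos (k * (x - t)) = 0 := by
  have h1 := integral_cos_mul_cos hjk 0 (-(k * x))
  have h2 := integral_cos_mul_cos hjk (-(π / 2)) (-(k * x))
  have : ∀ t : ℝ, (u * Real.cos (j * t) + v * Real.sin (j * t)) * Real.cos (k * (x - t)) =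
      u * (Real.cos (j * t + 0) * Real.cos (k * t + -(k * x))) +
      v * (Real.cos (j * t + -(π / 2)) * Real.cos (k * t + -(k * x))) := by
    intro t
    rw [← sub_eq_add_neg _ (π / 2), Real.cos_sub_pi_div_two, ← Real.cos_neg (k * (x - t))]
    ring_nf
  simp_rw [this]
  rw [integral_add, integral_const_mul, integral_const_mul, h1, h2]
  · simp
  all_goals exact Continuous.intervalIntegrable (by fun_prop) _ _

theorem integral_harmonic_mul_cos {k : ℕ} (hk : 1 ≤ k) (u v x : ℝ) :
    ∫ t in (-π)..π, (u * Real.cos (k * t) + v * Real.sin (k * t)) * Real.cos (k * (x - t)) =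
      π * (u * Real.cos (k * x) + v * Real.sin (k * x)) := by
  have hk' : (2 * k : ℤ) ≠ 0 := by omega
  have h1 := integral_cos_int_mul_add hk' (-(k * x))
  have h2 := integral_cos_int_mul_add hk' (-(k * x) - π / 2)
  have : ∀ t : ℝ, (u * Real.cos (k * t) + v * Real.sin (k * t)) * Real.cos (k * (x - t)) =
      (u * Real.cos (k * x) + v * Real.sin (k * x)) / 2 +
      ((u / 2) * Real.cos ((2 * k : ℤ) * t + -(k * x)) +
      (v / 2) * Real.cos ((2 * k : ℤ) * t + (-(k * x) - π / 2))) := by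
    intro t
    rw [← add_sub_assoc, Real.cos_sub_pi_div_two]
    push_cast
    rw [show 2 * (k : ℝ) * t + -(k * x) = k * t - k * (x - t) by ring,
      show (k : ℝ) * x = k * t + k * (x - t) by ring, Real.cos_sub, Real.sin_sub, Real.cos_add,
      Real.sin_add]
    ring
  simp_rw [this]
  rw [integral_add, integral_add, integral_const_mul, integral_const_mul, h1, h2]
  · simp
    ring
  all_goals exact Continuous.intervalIntegrable (by fun_prop) _ _

theorem integral_trigPoly_mul_cos {m k : ℕ} (hk : m ≤ k) {T : ℝ → ℝ} (hT : T ∈ trigPoly m)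
    (x : ℝ) : ∫ t in (-π)..π, T t * Real.cos (k * (x - t)) = 0 := by
  obtain ⟨α, γ, rfl⟩ := hT
  simp only [Finset.sum_mul]
  rw [integral_finsetSum fun i _ => Continuous.intervalIntegrable (by fun_prop) _ _]
  refine Finset.sum_eq_zero fun j hj => integral_harmonic_mul_cos_of_ne ?_ _ _ _
  have := Finset.mem_range.1 hj
  omega

/-- Orthogonality makes frequencies `k ≥ m` blind to `T`; this is how best approximation enters the
estimates. -/
theorem harmonic_eq_integral_sub {φ : ℝ → ℝ} (hφ : IntervalIntegrable φ volume (-π) π) {m k : ℕ}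
    (hk : m ≤ k) {T : ℝ → ℝ} (hT : T ∈ trigPoly m) (x : ℝ) :
    harmonic φ k x = (1 / π) * ∫ t in (-π)..π, (φ t - T t) * Real.cos (k * (x - t)) := by
  have hTc := continuous_of_mem_trigPoly hT
  simp_rw [sub_mul]
  rw [harmonic_eq_integral hφ, integral_sub, integral_trigPoly_mul_cos hk hT, sub_zero]
  · exact hφ.mul_continuousOn (by fun_prop)
  · exact Continuous.intervalIntegrable (by fun_prop) _ _

/-! ### The `L_1` norm of two neighbouring cosines -/

theorem integral_add_const_of_periodic {h : ℝ → ℝ} (hp : Function.Periodic h (2 * π)) (c : ℝ) :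
    ∫ t in (-π)..π, h (t + c) = ∫ t in (-π)..π, h t := by
  rw [intervalIntegral.integral_comp_add_right]
  have := hp.intervalIntegral_add_eq (-π + c) (-π)
  rwa [show -π + c + 2 * π = π + c by ring, show -π + 2 * π = π by ring] at this

/-- The substitution sweeps `m` full periods, and its Jacobian `1/m` compensates. -/
theorem integral_nat_mul_sub_of_periodic {h : ℝ → ℝ} (hc : Continuous h)
    (hp : Function.Periodic h (2 * π)) {m : ℕ} (hm : 1 ≤ m) (y : ℝ) :
    ∫ t in (-π)..π, h (m * (y - t)) = ∫ t in (-π)..π, h t := by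
  have hm' : (m : ℝ) ≠ 0 := by positivity
  have e : ∀ t : ℝ, (m : ℝ) * (y - t) = m * y - m * t := fun t => by ring
  simp_rw [e]
  rw [intervalIntegral.integral_comp_sub_mul h hm']
  have h1 := hp.intervalIntegral_add_zsmul_eq m (m * y - m * π)
    (fun a b => hc.intervalIntegrable a b)
  have h2 := hp.intervalIntegral_add_eq (m * y - m * π) (-π)
  rw [show m * y - m * -π = m * y - m * π + (m : ℤ) • (2 * π) by
    rw [zsmul_eq_mul]; push_cast; ring, h1, h2, show -π + 2 * π = π by ring, zsmul_eq_mul,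
    smul_eq_mul]
  push_cast
  field_simp

theorem integral_comp_abs_cos {g : ℝ → ℝ} (hg : Continuous g) {m : ℕ} (hm : 1 ≤ m) (y : ℝ) :
    ∫ t in (-π)..π, g |Real.cos (m * (y - t))| = 4 * ∫ t in (0 : ℝ)..(π / 2), g (Real.sin t) := by
  have hi : ∀ a b, IntervalIntegrable (fun t => g |Real.sin t|) volume a b :=
    fun a b => Continuous.intervalIntegrable (by fun_prop) _ _
  rw [integral_nat_mul_sub_of_periodic (h := fun u => g |Real.cos u|) (by fun_prop)
    (fun u => by simp) hm,
    ← integral_add_const_of_periodic (h := fun u => g |Real.cos u|) (fun u => by simp) (π / 2)]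
  simp only [Real.cos_add_pi_div_two, abs_neg]
  have h1 : ∫ t in (-π)..0, g |Real.sin t| = ∫ t in (0 : ℝ)..π, g |Real.sin t| := by
    have := intervalIntegral.integral_comp_neg (a := 0) (b := π) (fun t => g |Real.sin t|)
    simp only [Real.sin_neg, abs_neg, neg_zero] at this
    exact this.symm
  have h2 : ∫ t in (π / 2)..π, g |Real.sin t| = ∫ t in (0 : ℝ)..(π / 2), g |Real.sin t| := by
    have := intervalIntegral.integral_comp_sub_left (a := 0) (b := π / 2)
      (fun t => g |Real.sin t|) π
    simp only [Real.sin_pi_sub, sub_zero, show π - π / 2 = π / 2 by ring] at this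
    exact this.symm
  have h3 : ∫ t in (0 : ℝ)..(π / 2), g |Real.sin t| = ∫ t in (0 : ℝ)..(π / 2), g (Real.sin t) := by
    refine integral_congr fun t ht => ?_
    rw [Set.uIcc_of_le (by positivity)] at ht
    rw [abs_of_nonneg (Real.sin_nonneg_of_nonneg_of_le_pi ht.1 (by linarith [ht.2, Real.pi_pos]))]
  rw [← integral_add_adjacent_intervals (hi (-π) 0) (hi 0 π), h1,
    ← integral_add_adjacent_intervals (hi 0 (π / 2)) (hi (π / 2) π), h2, h3]
  ring

theorem integral_abs_cos {m : ℕ} (hm : 1 ≤ m) (y : ℝ) :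
    ∫ t in (-π)..π, |Real.cos (m * (y - t))| = 4 := by
  rw [integral_comp_abs_cos (g := fun u => u) continuous_id hm y]
  simp

/-- On a quarter period Jordan's inequality `sin t ≥ 2t/π` bounds the excess of the maximum over `a
sin t` by the positive part of a decreasing line, which has height `b` and base of order `b/a`. -/
theorem integral_max_abs_cos_le {m : ℕ} (hm : 1 ≤ m) (y : ℝ) {a b : ℝ} (ha : 0 < a) (hb : 0 ≤ b) :
    ∫ t in (-π)..π, max (a * |Real.cos (m * (y - t))|) b ≤ 4 * a + 2 * π * (b ^ 2 / a) := by
  have hpi := Real.pi_pos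
  rw [integral_comp_abs_cos (g := fun u => max (a * u) b) (by fun_prop) hm y]
  -- The zero of the line `b - (2a/π) t`.
  set r : ℝ := π * b / (2 * a) with hr
  have hr0 : 0 ≤ r := by positivity
  have hi : ∀ u v, IntervalIntegrable (fun t => max (b - 2 * a / π * t) 0) volume u v :=
    fun u v => Continuous.intervalIntegrable (by fun_prop) _ _
  have h0 : ∀ t ∈ Set.Icc (0 : ℝ) (π / 2),
      max (a * Real.sin t) b ≤ a * Real.sin t + max (b - 2 * a / π * t) 0 := by
    intro t ht
    have hj := mul_le_mul_of_nonneg_left (Real.mul_le_sin ht.1 ht.2) ha.le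
    have e : 2 * a / π * t = a * (2 / π * t) := by ring
    rw [e]
    refine max_le ?_ ?_
    · linarith [le_max_right (b - a * (2 / π * t)) 0]
    · linarith [le_max_left (b - a * (2 / π * t)) 0]
  have h1 : ∫ t in (0 : ℝ)..(π / 2), max (a * Real.sin t) b ≤
      a + ∫ t in (0 : ℝ)..(π / 2), max (b - 2 * a / π * t) 0 := by
    calc _ ≤ ∫ t in (0 : ℝ)..(π / 2), (a * Real.sin t + max (b - 2 * a / π * t) 0) :=
          integral_mono_on (by positivity) (Continuous.intervalIntegrable (by fun_prop) _ _)
            (Continuous.intervalIntegrable (by fun_prop) _ _) h0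
      _ = _ := by
          rw [integral_add (Continuous.intervalIntegrable (by fun_prop) _ _) (hi _ _)]
          simp
  -- Enlarging the interval past `r` avoids comparing `r` with `π / 2`.
  have h2 : ∫ t in (0 : ℝ)..(π / 2), max (b - 2 * a / π * t) 0 ≤
      ∫ t in (0 : ℝ)..(r + π / 2), max (b - 2 * a / π * t) 0 :=
    integral_mono_interval le_rfl (by positivity) (by linarith)
      (Filter.Eventually.of_forall fun t => le_max_right _ _) (hi _ _)
  have h3 : ∫ t in (0 : ℝ)..r, max (b - 2 * a / π * t) 0 ≤ r * b := by
    calc _ ≤ ∫ t in (0 : ℝ)..r, b := by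
          refine integral_mono_on hr0 (hi _ _) (by simp) fun t ht => max_le ?_ hb
          have : 0 ≤ 2 * a / π * t := mul_nonneg (by positivity) ht.1
          linarith
      _ = _ := by simp
  have h4 : ∫ t in r..(r + π / 2), max (b - 2 * a / π * t) 0 = 0 := by
    refine (integral_congr (g := fun _ => (0 : ℝ)) fun t ht => ?_).trans (by simp)
    rw [Set.uIcc_of_le (by linarith)] at ht
    change max (b - 2 * a / π * t) 0 = 0
    refine max_eq_right ?_
    have := mul_le_mul_of_nonneg_left ht.1 (show 0 ≤ 2 * a / π by positivity)
    have e : 2 * a / π * r = b := by rw [hr]; field_simp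
    linarith
  rw [← integral_add_adjacent_intervals (hi 0 r) (hi r (r + π / 2)), h4, add_zero] at h2
  have e : 4 * (r * b) = 2 * π * (b ^ 2 / a) := by rw [hr]; field_simp; ring
  linarith

theorem abs_add_add_abs_sub (a b : ℝ) : |a + b| + |a - b| = 2 * max |a| |b| := by
  rcases le_total 0 (a + b) with h1 | h1 <;> rcases le_total 0 (a - b) with h2 | h2 <;>
  rcases le_total 0 a with h3 | h3 <;> rcases le_total 0 b with h4 | h4 <;>
  simp only [abs_of_nonneg, abs_of_nonpos, h1, h2, h3, h4] <;>
  rcases le_total |a| |b| with h5 | h5 <;>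
  simp only [abs_of_nonneg, abs_of_nonpos, h3, h4] at h5 <;>
  simp only [max_eq_left, max_eq_right, h5] <;> linarith

theorem cos_nat_mul_add_pi (k : ℕ) (x : ℝ) :
    Real.cos (k * (x + π)) = (-1) ^ k * Real.cos (k * x) := by
  rw [mul_add, Real.cos_add_nat_mul_pi]

theorem sin_nat_mul_add_pi (k : ℕ) (x : ℝ) :
    Real.sin (k * (x + π)) = (-1) ^ k * Real.sin (k * x) := by
  rw [mul_add, Real.sin_add_nat_mul_pi]

/-- The frequencies have opposite parity, so translation by `π` turns `|A + B|` into `|A - B|`.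
Their integrals agree, and `|A + B| + |A - B| = 2 max |A| |B|`. The phases `y` and `z` play no role.
-/
theorem integral_abs_two_cos_le {m : ℕ} (hm : 1 ≤ m) (y z : ℝ) {a b : ℝ} (ha : 0 < a)
    (hb : 0 ≤ b) :
    ∫ t in (-π)..π, |a * Real.cos (m * (y - t)) + b * Real.cos ((m + 1 : ℕ) * (z - t))| ≤
      4 * a + 2 * π * (b ^ 2 / a) := by
  set A : ℝ → ℝ := fun t => a * Real.cos (m * (y - t)) with hA
  set B : ℝ → ℝ := fun t => b * Real.cos ((m + 1 : ℕ) * (z - t)) with hB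
  have hAc : Continuous A := by fun_prop
  have hBc : Continuous B := by fun_prop
  have hAs : ∀ t, A (t - π) = (-1) ^ m * A t := fun t => by
    simp only [hA]
    rw [show y - (t - π) = y - t + π by ring, cos_nat_mul_add_pi]
    ring
  have hBs : ∀ t, B (t - π) = (-1) ^ (m + 1) * B t := fun t => by
    simp only [hB]
    rw [show z - (t - π) = z - t + π by ring, cos_nat_mul_add_pi]
    ring
  have hS : ∀ t, |A (t - π) + B (t - π)| = |A t - B t| := fun t => by
    rw [hAs, hBs, show (-1) ^ m * A t + (-1) ^ (m + 1) * B t = (-1) ^ m * (A t - B t) by ring,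
      abs_mul]
    simp
  have hS' : ∀ t, |A (t - π) - B (t - π)| = |A t + B t| := fun t => by
    rw [hAs, hBs, show (-1) ^ m * A t - (-1) ^ (m + 1) * B t = (-1) ^ m * (A t + B t) by ring,
      abs_mul]
    simp
  have hp : Function.Periodic (fun t => |A t + B t|) (2 * π) := fun t => by
    have h1 := hS (t + 2 * π)
    have h2 := hS' (t + π)
    rw [show t + 2 * π - π = t + π by ring] at h1
    rw [add_sub_cancel_right] at h2
    have h3 := hS' (t + 2 * π)
    have h4 := hS (t + π)
    rw [show t + 2 * π - π = t + π by ring] at h3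
    rw [add_sub_cancel_right] at h4
    change |A (t + 2 * π) + B (t + 2 * π)| = |A t + B t|
    rw [← h3, ← h4]
  have h1 := integral_add_const_of_periodic hp (-π)
  simp only [← sub_eq_add_neg, hS] at h1
  have h2 : (∫ t in (-π)..π, |A t + B t|) + ∫ t in (-π)..π, |A t - B t| =
      2 * ∫ t in (-π)..π, max |A t| |B t| := by
    rw [← integral_add (Continuous.intervalIntegrable (by fun_prop) _ _)
      (Continuous.intervalIntegrable (by fun_prop) _ _), ← integral_const_mul]
    simp only [abs_add_add_abs_sub]
  have h3 : ∫ t in (-π)..π, max |A t| |B t| ≤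
      ∫ t in (-π)..π, max (a * |Real.cos (m * (y - t))|) b := by
    refine integral_mono_on (by linarith [Real.pi_pos])
      (Continuous.intervalIntegrable (by fun_prop) _ _)
      (Continuous.intervalIntegrable (by fun_prop) _ _) fun t _ => max_le_max ?_ ?_
    · simp only [hA, abs_mul, abs_of_pos ha, le_refl]
    · simp only [hB, abs_mul, abs_of_nonneg hb]
      exact mul_le_of_le_one_right hb (Real.abs_cos_le_one _)
  have h4 := integral_max_abs_cos_le hm y ha hb
  change ∫ t in (-π)..π, |A t + B t| ≤ _
  linarith

/-! ### Pointwise convergence of the real Fourier series -/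

instance fact_two_pi_pos : Fact (0 < 2 * π) := ⟨Real.two_pi_pos⟩

theorem fourier_coe_two_pi (n : ℤ) (x : ℝ) :
    fourier n (x : AddCircle (2 * π)) = Real.cos (n * x) + Real.sin (n * x) * Complex.I := by
  rw [fourier_coe_apply, Complex.ofReal_cos, Complex.ofReal_sin, ← Complex.exp_mul_I]
  congr 1
  have : (π : ℂ) ≠ 0 := by exact_mod_cast Real.pi_ne_zero
  push_cast
  field_simp

theorem fourierCoeff_lift {f : ℝ → ℝ} (hf : f ∈ spaceC) (g : AddCircle (2 * π) → ℂ)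
    (hg : ∀ x : ℝ, g x = f x) (n : ℤ) :
    fourierCoeff g n = ((1 / (2 * π)) * ∫ t in (-π)..π, f t * Real.cos (n * t) : ℝ) -
      ((1 / (2 * π)) * ∫ t in (-π)..π, f t * Real.sin (n * t) : ℝ) * Complex.I := by
  have hc := hf.2
  rw [fourierCoeff_eq_intervalIntegral g n (-π), show -π + 2 * π = π by ring]
  have h : ∀ x : ℝ, fourier (-n) (x : AddCircle (2 * π)) • g x =
      ((f x * Real.cos (n * x) : ℝ) : ℂ) - ((f x * Real.sin (n * x) : ℝ) : ℂ) * Complex.I := by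
    intro x
    rw [fourier_coe_two_pi, hg, smul_eq_mul]
    push_cast
    rw [neg_mul, Complex.cos_neg, Complex.sin_neg]
    ring
  simp_rw [h]
  rw [integral_sub, integral_mul_const, integral_ofReal, integral_ofReal, Complex.real_smul]
  · push_cast
    ring
  all_goals exact Continuous.intervalIntegrable (by fun_prop) _ _

/-- Absolutely summable coefficients make the complex Fourier series converge pointwise to the
continuous `f`; the terms of index `k` and `-k` combine into the real harmonic. -/
theorem hasSum_harmonic {f : ℝ → ℝ} (hf : f ∈ spaceC)
    (ha : Summable fun k => |fourierA f k|) (hb : Summable fun k => |fourierB f k|) (x : ℝ) :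
    HasSum (fun k => harmonic f (k + 1) x) (f x - fourierA f 0 / 2) := by
  obtain ⟨hp, hc⟩ := hf
  have hp' : Function.Periodic (fun x => (f x : ℂ)) (2 * π) := fun x => by simp [hp x]
  let g : C(AddCircle (2 * π), ℂ) :=
    ⟨hp'.lift, continuous_coinduced_dom.mpr (Complex.continuous_ofReal.comp hc)⟩
  have hg : ∀ x : ℝ, g x = f x := fun x => hp'.lift_coe x
  have hpos : ∀ k : ℕ, fourierCoeff g (k : ℤ) = (fourierA f k - fourierB f k * Complex.I) / 2 := by
    intro k
    rw [fourierCoeff_lift ⟨hp, hc⟩ g hg, fourierA, fourierB]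
    push_cast
    ring
  have hneg : ∀ k : ℕ, fourierCoeff g (-(k : ℤ)) =
      (fourierA f k + fourierB f k * Complex.I) / 2 := by
    intro k
    rw [fourierCoeff_lift ⟨hp, hc⟩ g hg, fourierA, fourierB]
    have h1 : ∀ t : ℝ, Real.cos ((-(k : ℤ) : ℤ) * t) = Real.cos (k * t) := fun t => by
      push_cast
      rw [neg_mul, Real.cos_neg]
    have h2 : ∀ t : ℝ, f t * Real.sin ((-(k : ℤ) : ℤ) * t) = -(f t * Real.sin (k * t)) :=
      fun t => by
        push_cast
        rw [neg_mul, Real.sin_neg]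
        ring
    simp_rw [h1, h2]
    rw [integral_neg]
    push_cast
    ring
  have hs : Summable (fourierCoeff g) := by
    have hsum := ha.add hb
    refine Summable.of_nat_of_neg ?_ ?_
    · refine Summable.of_norm_bounded hsum fun k => ?_
      rw [hpos, norm_div]
      have := norm_sub_le (fourierA f k : ℂ) (fourierB f k * Complex.I)
      simp only [norm_mul, Complex.norm_I, mul_one, Complex.norm_real, Real.norm_eq_abs] at this
      norm_num
      linarith [abs_nonneg (fourierA f k), abs_nonneg (fourierB f k)]
    · refine Summable.of_norm_bounded hsum fun k => ?_
      rw [hneg, norm_div]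
      have := norm_add_le (fourierA f k : ℂ) (fourierB f k * Complex.I)
      simp only [norm_mul, Complex.norm_I, mul_one, Complex.norm_real, Real.norm_eq_abs] at this
      norm_num
      linarith [abs_nonneg (fourierA f k), abs_nonneg (fourierB f k)]
  have h := (has_pointwise_sum_fourier_series_of_summable hs (x : AddCircle (2 * π))).nat_add_neg
  have hterm : ∀ k : ℕ, fourierCoeff g (k : ℤ) • fourier (k : ℤ) (x : AddCircle (2 * π)) +
      fourierCoeff g (-(k : ℤ)) • fourier (-(k : ℤ)) (x : AddCircle (2 * π)) =
      ((harmonic f k x : ℝ) : ℂ) := by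
    intro k
    rw [hpos, hneg, fourier_coe_two_pi, fourier_coe_two_pi, harmonic]
    push_cast
    rw [neg_mul, Complex.cos_neg, Complex.sin_neg]
    simp only [smul_eq_mul]
    linear_combination (-(fourierB f k : ℂ) * Complex.sin (k * x)) * Complex.I_sq
  simp_rw [hterm] at h
  have h0 : fourierCoeff g 0 = ((fourierA f 0 / 2 : ℝ) : ℂ) := by
    have := hpos 0
    simp only [Nat.cast_zero] at this
    rw [this, fourierB]
    simp
  -- Pairing `k` with `-k` counts the constant term twice, hence the extra `fourierA f 0 / 2`.
  have hr : HasSum (fun k => harmonic f k x) (f x + fourierA f 0 / 2) := by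
    rw [hg, h0, fourier_zero, smul_eq_mul, mul_one] at h
    exact_mod_cast h
  have := (hasSum_nat_add_iff' 1).2 hr
  simp only [Finset.range_one, Finset.sum_singleton] at this
  convert! this using 1
  simp [harmonic]
  ring

/-! ### Bounds on harmonics through the derivative -/

theorem intervalIntegrable_of_mem_spaceL_one {f : ℝ → ℝ} (hf : f ∈ spaceL 1) :
    IntervalIntegrable f volume (-π) π := by
  rw [intervalIntegrable_iff_integrableOn_Ioc_of_le (by linarith [Real.pi_pos])]
  exact MeasureTheory.memLp_one_iff_integrable.1 hf.2

theorem zero_mem_trigPoly (m : ℕ) : (fun _ => 0) ∈ trigPoly m :=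
  ⟨fun _ => 0, fun _ => 0, by simp⟩

theorem abs_integral_mul_le {g w : ℝ → ℝ} {M : ℝ} (hg : ∀ᵐ t ∂periodMeasure, |g t| ≤ M)
    (hw : Continuous w) :
    |∫ t in (-π)..π, g t * w t| ≤ M * ∫ t in (-π)..π, |w t| := by
  rw [← integral_const_mul, ← Real.norm_eq_abs]
  refine norm_integral_le_of_norm_le (by linarith [Real.pi_pos]) ?_
    (Continuous.intervalIntegrable (by fun_prop) _ _)
  rw [periodMeasure, MeasureTheory.ae_restrict_iff' measurableSet_Ioc] at hg
  filter_upwards [hg] with t ht hmem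
  rw [Real.norm_eq_abs, abs_mul]
  exact mul_le_mul_of_nonneg_right (ht hmem) (abs_nonneg _)

theorem nonneg_of_ae_abs_le {g : ℝ → ℝ} {M : ℝ} (hg : ∀ᵐ t ∂periodMeasure, |g t| ≤ M) :
    0 ≤ M := by
  have := (abs_nonneg _).trans (abs_integral_mul_le hg (w := fun _ => 1) continuous_const)
  simp only [abs_one, integral_const, smul_eq_mul, mul_one] at this
  exact nonneg_of_mul_nonneg_left this (by linarith [Real.pi_pos])

/-- The crude bound `|cos| ≤ 1` suffices, since this estimate serves only summability and the tail.
-/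
theorem abs_harmonic_le {φ : ℝ → ℝ} (hφ : IntervalIntegrable φ volume (-π) π) {m k : ℕ}
    (hk : m ≤ k) {T : ℝ → ℝ} (hT : T ∈ trigPoly m) {M : ℝ}
    (hM : ∀ᵐ t ∂periodMeasure, |φ t - T t| ≤ M) (x : ℝ) : |harmonic φ k x| ≤ 2 * M := by
  have hpi := Real.pi_pos
  have hM0 := nonneg_of_ae_abs_le hM
  rw [harmonic_eq_integral_sub hφ hk hT, abs_mul, abs_of_pos (by positivity : 0 < 1 / π)]
  have h1 := abs_integral_mul_le hM (w := fun t => Real.cos (k * (x - t))) (by fun_prop)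
  have h2 : ∫ t in (-π)..π, |Real.cos (k * (x - t))| ≤ ∫ t in (-π)..π, (1 : ℝ) :=
    integral_mono_on (by linarith) (Continuous.intervalIntegrable (by fun_prop) _ _) (by simp)
      fun t _ => Real.abs_cos_le_one _
  simp only [integral_const, smul_eq_mul, mul_one] at h2
  calc _ ≤ 1 / π * (M * (π - -π)) := by gcongr; exact h1.trans (by gcongr)
    _ = 2 * M := by field_simp; ring

/-- At frequency `k`, the phase `β_k π/2` is a translation of the argument by `β_k π/(2k)`. -/
theorem IsPsiBetaDeriv.harmonic_eq {ψ β : ℕ → ℝ} {f φ : ℝ → ℝ} (h : IsPsiBetaDeriv ψ β f φ)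
    {k : ℕ} (hk : 1 ≤ k) (hψ : 0 < ψ k) (x : ℝ) :
    harmonic f k x = ψ k * harmonic φ k (x - β k * π / (2 * k)) := by
  have hk' : (k : ℝ) ≠ 0 := by positivity
  have h1 := h.2.2.2 k hk (x - β k * π / (2 * k))
  rw [show (k : ℝ) * (x - β k * π / (2 * k)) + β k * π / 2 = k * x by field_simp; ring] at h1
  rw [harmonic, harmonic, h1]
  field_simp

theorem IsD0.summable_succ {ψ : ℕ → ℝ} (h : IsD0 ψ) : Summable fun k => ψ (k + 1) := by
  refine summable_of_ratio_test_tendsto_lt_one zero_lt_one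
    (Filter.Eventually.of_forall fun k => (h.1 (k + 1) (by omega)).ne') ?_
  refine ((Filter.tendsto_add_atTop_iff_nat 1).2 h.2).congr fun k => ?_
  rw [Real.norm_of_nonneg (h.1 _ (by omega)).le, Real.norm_of_nonneg (h.1 _ (by omega)).le]

/-- The harmonic takes the value `a_k` at `0` and `b_k` at `π/(2k)`, so a uniform bound on harmonics
bounds both coefficients. -/
theorem summable_abs_fourier {ψ β : ℕ → ℝ} (hψ : IsD0 ψ) {f φ : ℝ → ℝ}
    (h : IsPsiBetaDeriv ψ β f φ) {T : ℝ → ℝ} {m : ℕ} (hT : T ∈ trigPoly m) {M : ℝ}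
    (hM : ∀ᵐ t ∂periodMeasure, |φ t - T t| ≤ M) :
    (Summable fun k => |fourierA f k|) ∧ Summable fun k => |fourierB f k| := by
  have hφ := intervalIntegrable_of_mem_spaceL_one h.2.1
  have key : ∀ k x, |harmonic f (k + m + 1) x| ≤ ψ (k + m + 1) * (2 * M) := fun k x => by
    have hpos := hψ.1 (k + m + 1) (by omega)
    rw [h.harmonic_eq (by omega) hpos, abs_mul, abs_of_pos hpos]
    exact mul_le_mul_of_nonneg_left (abs_harmonic_le hφ (by omega) hT hM _) hpos.le
  have hs : Summable fun k => ψ (k + m + 1) * (2 * M) :=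
    ((summable_nat_add_iff m).2 hψ.summable_succ).mul_right _
  constructor
  · refine (summable_nat_add_iff (m + 1)).1 (Summable.of_nonneg_of_le (fun _ => abs_nonneg _)
      (fun k => ?_) hs)
    have := key k 0
    rwa [harmonic, mul_zero, Real.cos_zero, Real.sin_zero, mul_one, mul_zero, add_zero] at this
  · refine (summable_nat_add_iff (m + 1)).1 (Summable.of_nonneg_of_le (fun _ => abs_nonneg _)
      (fun k => ?_) hs)
    have hk : ((k + m + 1 : ℕ) : ℝ) ≠ 0 := by positivity
    have := key k (π / 2 / (k + m + 1 : ℕ))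
    rwa [harmonic, mul_div_cancel₀ _ hk, Real.cos_pi_div_two, Real.sin_pi_div_two, mul_zero,
      zero_add, mul_one] at this

/-! ### The series of the deviation and its tail -/

theorem hasSum_sub_fourierSum {f : ℝ → ℝ} {x : ℝ}
    (h : HasSum (fun k => harmonic f (k + 1) x) (f x - fourierA f 0 / 2)) (k : ℕ) :
    HasSum (fun j => if k < j + 1 then harmonic f (j + 1) x else 0) (f x - fourierSum k f x) := by
  have h1 : HasSum (fun j => if j < k then harmonic f (j + 1) x else 0)
      (∑ j ∈ Finset.range k, if j < k then harmonic f (j + 1) x else 0) :=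
    hasSum_sum_of_ne_finset_zero fun j hj => by simp_all
  convert! h.sub h1 using 1
  · ext j
    by_cases hj : j < k
    · simp [hj, show ¬ k < j + 1 by omega]
    · simp [hj, show k < j + 1 by omega]
  · have h2 : ∑ j ∈ Finset.range k, (if j < k then harmonic f (j + 1) x else 0) =
        ∑ j ∈ Finset.range k, harmonic f (j + 1) x :=
      Finset.sum_congr rfl fun j hj => by simp_all
    rw [h2, fourierSum, Finset.range_eq_Ico, Finset.sum_Ico_add' (fun j => harmonic f j x) 0 k 1]
    simp only [harmonic]
    rw [show Finset.Ico (0 + 1) (k + 1) = Finset.Icc 1 k by ext; simp]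
    ring

theorem tau_add_eq {q p : ℕ} (hp : 1 ≤ p) (j : ℕ) :
    tau (q + p) p (q + 1 + j) = (min (j + 1) p : ℕ) / (p : ℝ) := by
  have hp' : (p : ℝ) ≠ 0 := by positivity
  rw [tau]
  split_ifs with h
  · rw [min_eq_left (by omega)]
    push_cast
    field_simp
    ring
  · rw [min_eq_right (by omega), div_self hp']

theorem hasSum_rho {f : ℝ → ℝ} {x : ℝ}
    (h : HasSum (fun k => harmonic f (k + 1) x) (f x - fourierA f 0 / 2)) {q p : ℕ}
    (hp : 1 ≤ p) :
    HasSum (fun j => tau (q + p) p (q + 1 + j) * harmonic f (q + 1 + j) x)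
      (rho (q + p) p f x) := by
  have hp' : (p : ℝ) ≠ 0 := by positivity
  have h1 := (hasSum_sum (s := Finset.Ico q (q + p)) fun k _ =>
    hasSum_sub_fourierSum h k).mul_left (1 / (p : ℝ))
  have hval : 1 / (p : ℝ) * ∑ k ∈ Finset.Ico q (q + p), (f x - fourierSum k f x) =
      rho (q + p) p f x := by
    rw [rho, vallee, Finset.sum_sub_distrib, Finset.sum_const, Nat.card_Ico, Nat.add_sub_cancel,
      Nat.add_sub_cancel_left, nsmul_eq_mul]
    field_simp
  -- Frequency `j + 1` survives in `f - S_k` exactly when `k < j + 1`; `tau` is the proportion of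
  -- such `k`.
  have hterm : ∀ j, ∑ k ∈ Finset.Ico q (q + p), (if k < j + 1 then harmonic f (j + 1) x else 0) =
      ((Finset.Ico q (min (j + 1) (q + p))).card : ℝ) * harmonic f (j + 1) x := by
    intro j
    rw [← Finset.sum_filter, Finset.sum_const, nsmul_eq_mul]
    congr 3
    ext k
    simp
    omega
  rw [hval] at h1
  simp_rw [hterm] at h1
  -- Frequencies `1, …, q` lie in every partial sum and contribute nothing.
  have h2 := (hasSum_nat_add_iff' q).2 h1
  rw [Finset.sum_eq_zero, sub_zero] at h2
  · convert! h2 using 1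
    ext j
    rw [tau_add_eq hp, Nat.card_Ico, show min (j + q + 1) (q + p) - q = min (j + 1) p by omega,
      show j + q + 1 = q + 1 + j by omega]
    ring
  · intro j hj
    have := Finset.mem_range.1 hj
    rw [Nat.card_Ico, show min (j + 1) (q + p) - q = 0 by omega]
    simp

/-- The part of `remainder` coming from the frequencies `k ≥ q + 3`, with `q = n - p`. -/
noncomputable def tailSum (ψ : ℕ → ℝ) (q p : ℕ) : ℝ :=
  (p : ℝ) * ∑' j : ℕ, ψ (q + 3 + j) * tau (q + p) p (q + 3 + j)

theorem tau_add_mem_Icc {q p : ℕ} (hp : 1 ≤ p) (j : ℕ) :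
    tau (q + p) p (q + 1 + j) ∈ Set.Icc (0 : ℝ) 1 := by
  rw [tau_add_eq hp]
  refine ⟨by positivity, div_le_one_of_le₀ ?_ (by positivity)⟩
  exact_mod_cast min_le_right _ _

theorem summable_mul_tau {ψ : ℕ → ℝ} (hψ : IsD0 ψ) {q p : ℕ} (hp : 1 ≤ p) :
    Summable fun j => ψ (q + 3 + j) * tau (q + p) p (q + 3 + j) := by
  have hs : Summable fun j => ψ (q + 3 + j) :=
    ((summable_nat_add_iff (q + 2)).2 hψ.summable_succ).congr fun j => by
      congr 1; omega
  have ht : ∀ j, tau (q + p) p (q + 3 + j) ∈ Set.Icc (0 : ℝ) 1 := fun j => by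
    rw [show q + 3 + j = q + 1 + (2 + j) by omega]
    exact tau_add_mem_Icc hp _
  exact Summable.of_nonneg_of_le (fun j => mul_nonneg (hψ.1 _ (by omega)).le (ht j).1)
    (fun j => mul_le_of_le_one_right (hψ.1 _ (by omega)).le (ht j).2) hs

theorem tailSum_nonneg {ψ : ℕ → ℝ} (hψ : IsD0 ψ) {q p : ℕ} (hp : 1 ≤ p) : 0 ≤ tailSum ψ q p := by
  refine mul_nonneg (by positivity) (tsum_nonneg fun j => ?_)
  have := (tau_add_mem_Icc (q := q) hp (2 + j)).1
  rw [show q + 1 + (2 + j) = q + 3 + j by omega] at this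
  exact mul_nonneg (hψ.1 _ (by omega)).le this

theorem abs_rho_sub_le {ψ β : ℕ → ℝ} (hψ : IsD0 ψ) {f φ : ℝ → ℝ} (hf : f ∈ spaceC)
    (h : IsPsiBetaDeriv ψ β f φ) {q p : ℕ} (hp : 1 ≤ p) {T : ℝ → ℝ} (hT : T ∈ trigPoly (q + 1))
    {M : ℝ} (hM : ∀ᵐ t ∂periodMeasure, |φ t - T t| ≤ M) (x : ℝ) :
    |p * rho (q + p) p f x -
      (harmonic f (q + 1) x + (min 2 p : ℕ) * harmonic f (q + 2) x)| ≤
      2 * M * tailSum ψ q p := by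
  have hp' : (p : ℝ) ≠ 0 := by positivity
  have hφ := intervalIntegrable_of_mem_spaceL_one h.2.1
  obtain ⟨ha, hb⟩ := summable_abs_fourier hψ h hT hM
  have h1 := (hasSum_nat_add_iff' 2).2 (hasSum_rho (hasSum_harmonic hf ha hb x) (q := q) hp)
  have e0 : tau (q + p) p (q + 1) = 1 / p := by
    have := tau_add_eq (q := q) hp 0
    rw [min_eq_left (by omega)] at this
    simpa using this
  have e1 := tau_add_eq (q := q) hp 1
  simp only [Finset.sum_range_succ, Finset.sum_range_zero, zero_add, add_zero, e0, e1] at h1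
  have h2 : |rho (q + p) p f x - (1 / p * harmonic f (q + 1) x +
      (min (1 + 1) p : ℕ) / p * harmonic f (q + 1 + 1) x)| ≤
      (∑' j : ℕ, ψ (q + 3 + j) * tau (q + p) p (q + 3 + j)) * (2 * M) := by
    rw [← h1.tsum_eq, ← Real.norm_eq_abs, ← tsum_mul_right]
    refine tsum_of_norm_bounded ((summable_mul_tau hψ hp).mul_right _).hasSum fun j => ?_
    have ht := (tau_add_mem_Icc (q := q) hp (j + 2)).1
    rw [show q + 1 + (j + 2) = q + 3 + j by omega] at ht ⊢
    have hpos := hψ.1 (q + 3 + j) (by omega)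
    rw [Real.norm_eq_abs, abs_mul, abs_of_nonneg ht, h.harmonic_eq (by omega) hpos, abs_mul,
      abs_of_pos hpos]
    have := abs_harmonic_le hφ (show q + 1 ≤ q + 3 + j by omega) hT hM
      (x - β (q + 3 + j) * π / (2 * (q + 3 + j : ℕ)))
    calc _ ≤ tau (q + p) p (q + 3 + j) * (ψ (q + 3 + j) * (2 * M)) := by gcongr
      _ = _ := by ring
  have h3 := mul_le_mul_of_nonneg_left h2 (show (0 : ℝ) ≤ p by positivity)
  rw [← abs_of_nonneg (show (0 : ℝ) ≤ p by positivity), ← abs_mul, abs_of_nonneg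
    (show (0 : ℝ) ≤ p by positivity)] at h3
  convert! h3 using 1
  · congr 1
    field_simp
  · rw [tailSum]
    ring

/-! ### The upper estimate -/

theorem abs_two_harmonics_le {ψ β : ℕ → ℝ} (hψ : IsD0 ψ) {f φ : ℝ → ℝ}
    (h : IsPsiBetaDeriv ψ β f φ) {q : ℕ} {c : ℝ} (hc0 : 0 ≤ c) (hc : c ≤ 2)
    {T : ℝ → ℝ} (hT : T ∈ trigPoly (q + 1))
    {M : ℝ} (hM : ∀ᵐ t ∂periodMeasure, |φ t - T t| ≤ M) (x : ℝ) :
    |harmonic f (q + 1) x + c * harmonic f (q + 2) x| ≤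
      (4 / π * ψ (q + 1) + 8 * (ψ (q + 2) ^ 2 / ψ (q + 1))) * M := by
  have hpi := Real.pi_pos
  have hM0 := nonneg_of_ae_abs_le hM
  have hφ := intervalIntegrable_of_mem_spaceL_one h.2.1
  have hTc := continuous_of_mem_trigPoly hT
  have hg : IntervalIntegrable (fun t => φ t - T t) volume (-π) π :=
    hφ.sub (hTc.intervalIntegrable _ _)
  have ha := hψ.1 (q + 1) (by omega)
  have hb := hψ.1 (q + 2) (by omega)
  rw [h.harmonic_eq (by omega) ha, h.harmonic_eq (by omega) hb,
    harmonic_eq_integral_sub hφ (by omega) hT, harmonic_eq_integral_sub hφ (by omega) hT]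
  set y := x - β (q + 1) * π / (2 * (q + 1 : ℕ))
  set z := x - β (q + 2) * π / (2 * (q + 2 : ℕ))
  set a := ψ (q + 1)
  set b := ψ (q + 2)
  have e : a * (1 / π * ∫ t in (-π)..π, (φ t - T t) * Real.cos ((q + 1 : ℕ) * (y - t))) +
      c * (b * (1 / π * ∫ t in (-π)..π, (φ t - T t) * Real.cos ((q + 2 : ℕ) * (z - t)))) =
      1 / π * ∫ t in (-π)..π, (φ t - T t) * (a * Real.cos ((q + 1 : ℕ) * (y - t)) +
        (c * b) * Real.cos ((q + 1 + 1 : ℕ) * (z - t))) := by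
    simp_rw [mul_add, mul_left_comm _ a, mul_left_comm _ (c * b)]
    rw [integral_add, integral_const_mul, integral_const_mul]
    · ring
    all_goals exact (hg.mul_continuousOn (by fun_prop)).const_mul _
  rw [e, abs_mul, abs_of_pos (by positivity : 0 < 1 / π)]
  have h1 := abs_integral_mul_le hM (w := fun t => a * Real.cos ((q + 1 : ℕ) * (y - t)) +
        (c * b) * Real.cos ((q + 1 + 1 : ℕ) * (z - t))) (by fun_prop)
  have h2 := integral_abs_two_cos_le (m := q + 1) (by omega) y z ha (mul_nonneg hc0 hb.le)
  -- The source of the constant 8: `c ≤ 2` gives the factor 4, and `2π/π` the factor 2.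
  have h3 : (c * b) ^ 2 ≤ 4 * b ^ 2 := by
    rw [mul_pow]
    gcongr
    nlinarith
  calc _ ≤ 1 / π * (M * (4 * a + 2 * π * (4 * b ^ 2 / a))) := by
        gcongr
        refine h1.trans ?_
        gcongr
        refine h2.trans ?_
        gcongr
    _ = _ := by field_simp; ring

theorem remainder_add_eq (ψ : ℕ → ℝ) (q p : ℕ) :
    remainder ψ (q + p) p = ψ (q + 2) ^ 2 / ψ (q + 1) + tailSum ψ q p := by
  simp [remainder, tailSum]

theorem abs_rho_le {ψ β : ℕ → ℝ} (hψ : IsD0 ψ) {f φ : ℝ → ℝ} (hf : f ∈ spaceC)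
    (h : IsPsiBetaDeriv ψ β f φ) {q p : ℕ} (hp : 1 ≤ p) {T : ℝ → ℝ} (hT : T ∈ trigPoly (q + 1))
    {M : ℝ} (hM : ∀ᵐ t ∂periodMeasure, |φ t - T t| ≤ M) (x : ℝ) :
    |rho (q + p) p f x| ≤
      1 / (p : ℝ) * (4 / π * ψ (q + 1) + 8 * remainder ψ (q + p) p) * M := by
  have hp' : (0 : ℝ) < p := by positivity
  have h1 := abs_rho_sub_le hψ hf h hp hT hM x
  have h2 := abs_two_harmonics_le hψ h (c := (min 2 p : ℕ)) (by positivity)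
    (by exact_mod_cast min_le_left _ _) hT hM x
  have h3 := mul_nonneg (nonneg_of_ae_abs_le hM) (tailSum_nonneg hψ (q := q) hp)
  have h4 := abs_add_le (p * rho (q + p) p f x -
      (harmonic f (q + 1) x + (min 2 p : ℕ) * harmonic f (q + 2) x))
      (harmonic f (q + 1) x + (min 2 p : ℕ) * harmonic f (q + 2) x)
  rw [sub_add_cancel, abs_mul, abs_of_pos hp'] at h4
  rw [remainder_add_eq, mul_assoc, one_div, ← div_eq_inv_mul, le_div_iff₀ hp']
  linarith

/-! ### Alternation and the clipped cosine -/

theorem spaceC_subset_spaceL_one {f : ℝ → ℝ} (hf : f ∈ spaceC) : f ∈ spaceL 1 :=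
  ⟨hf.1, MeasureTheory.memLp_one_iff_integrable.2 hf.2.integrableOn_Ioc⟩

theorem exists_abs_le_of_mem_spaceC {f : ℝ → ℝ} (hf : f ∈ spaceC) : ∃ M, ∀ x, |f x| ≤ M := by
  obtain ⟨M, hM⟩ := isCompact_Icc.exists_bound_of_continuousOn (s := Set.Icc 0 (2 * π))
    hf.2.continuousOn
  refine ⟨M, fun x => ?_⟩
  obtain ⟨y, hy, hxy⟩ := hf.1.exists_mem_Ico₀ Real.two_pi_pos x
  rw [hxy]
  exact hM y (Set.Ico_subset_Icc_self hy)

/-- For each frequency `k < m` the sum is a part of a geometric sum with ratio `exp(iπ(m + k)/m)`, a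
`2m`-th root of unity. The ratio is not 1, as `m ≤ m + k < 2m` excludes multiples of `2m`. -/
theorem sum_neg_one_pow_mul_trigPoly {m : ℕ} (hm : 1 ≤ m) {T : ℝ → ℝ} (hT : T ∈ trigPoly m) :
    ∑ j ∈ Finset.range (2 * m), (-1) ^ j * T (j * (π / m)) = 0 := by
  have hm' : (m : ℂ) ≠ 0 := by exact_mod_cast (by omega : m ≠ 0)
  have hpi : (π : ℂ) ≠ 0 := by exact_mod_cast Real.pi_ne_zero
  obtain ⟨α, γ, rfl⟩ := hT
  have key : ∀ k < m, ∑ j ∈ Finset.range (2 * m),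
      (-1 : ℂ) ^ j * Complex.exp ((k * (j * (π / m)) : ℝ) * Complex.I) = 0 := by
    intro k hk
    set r := Complex.exp (π * (m + k : ℕ) / m * Complex.I) with hr
    have h1 : ∀ j : ℕ, (-1 : ℂ) ^ j * Complex.exp ((k * (j * (π / m)) : ℝ) * Complex.I) =
        r ^ j := by
      intro j
      rw [← Complex.exp_pi_mul_I, ← Complex.exp_nat_mul, ← Complex.exp_nat_mul, ← Complex.exp_add]
      congr 1
      push_cast
      field_simp
    have h2 : r ^ (2 * m) = 1 := by
      rw [hr, ← Complex.exp_nat_mul, Complex.exp_eq_one_iff]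
      refine ⟨(m + k : ℕ), ?_⟩
      push_cast
      field_simp
    have h3 : r ≠ 1 := by
      intro h
      rw [hr, Complex.exp_eq_one_iff] at h
      obtain ⟨l, hl⟩ := h
      have h4 : ((m + k : ℕ) : ℂ) = 2 * l * m := by
        have := Complex.I_ne_zero
        field_simp at hl
        linear_combination hl
      have h5 : ((m + k : ℕ) : ℤ) = 2 * l * m := by exact_mod_cast h4
      push_cast at h5
      have hk0 : (0 : ℤ) ≤ k := by positivity
      have hkm : (k : ℤ) < m := by exact_mod_cast hk
      rcases le_or_gt l 0 with hl0 | hl0 <;> nlinarith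
    rw [Finset.sum_congr rfl fun j _ => h1 j]
    have := geom_sum_mul r (2 * m)
    rw [h2, sub_self] at this
    exact (mul_eq_zero.1 this).resolve_right (sub_ne_zero.2 h3)
  simp_rw [Finset.mul_sum]
  rw [Finset.sum_comm]
  refine Finset.sum_eq_zero fun k hk => ?_
  have h := key k (Finset.mem_range.1 hk)
  have hre := congrArg Complex.re h
  have him := congrArg Complex.im h
  have e : ∀ j : ℕ, (-1 : ℂ) ^ j = ((-1) ^ j : ℝ) := fun j => by push_cast; rfl
  simp only [e, Complex.re_sum, Complex.im_sum, Complex.re_ofReal_mul, Complex.im_ofReal_mul,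
    Complex.exp_ofReal_mul_I_re, Complex.exp_ofReal_mul_I_im, Complex.zero_re,
    Complex.zero_im] at hre him
  have : ∀ j : ℕ, (-1 : ℝ) ^ j * (α k * Real.cos (k * (j * (π / m))) +
      γ k * Real.sin (k * (j * (π / m)))) = α k * ((-1) ^ j * Real.cos (k * (j * (π / m)))) +
      γ k * ((-1) ^ j * Real.sin (k * (j * (π / m)))) := fun j => by ring
  simp_rw [this]
  rw [Finset.sum_add_distrib, ← Finset.mul_sum, ← Finset.mul_sum, hre, him]
  simp

/-- A function alternating between `±E` at `2m` equally spaced points has best approximation at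
least `E`. -/
theorem le_bestC_of_alternating {m : ℕ} (hm : 1 ≤ m) {g : ℝ → ℝ} (hg : g ∈ spaceC) {E : ℝ}
    (h : ∀ j : ℕ, g (j * (π / m)) = (-1) ^ j * E) : E ≤ bestC m g := by
  have : Nonempty (trigPoly m) := ⟨⟨_, zero_mem_trigPoly m⟩⟩
  refine le_ciInf fun ⟨T, hT⟩ => ?_
  have hgT : (fun x => g x - T x) ∈ spaceC :=
    ⟨hg.1.sub (periodic_of_mem_trigPoly hT), hg.2.sub (continuous_of_mem_trigPoly hT)⟩
  obtain ⟨M, hM⟩ := exists_abs_le_of_mem_spaceC hgT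
  have hb : BddAbove (Set.range fun x => |g x - T x|) := ⟨M, by rintro _ ⟨x, rfl⟩; exact hM x⟩
  -- The alternating sum over the nodes annihilates `T` and adds up the `2m` extremal values of `g`.
  have h1 : ∑ j ∈ Finset.range (2 * m), (-1) ^ j * (g (j * (π / m)) - T (j * (π / m))) =
      (2 * m : ℕ) * E := by
    simp_rw [mul_sub]
    rw [Finset.sum_sub_distrib, sum_neg_one_pow_mul_trigPoly hm hT, sub_zero]
    simp_rw [h, ← mul_assoc, ← mul_pow]
    simp
  have h2 : ∑ j ∈ Finset.range (2 * m), (-1) ^ j * (g (j * (π / m)) - T (j * (π / m))) ≤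
      ∑ j ∈ Finset.range (2 * m), normC fun x => g x - T x := by
    refine Finset.sum_le_sum fun j _ => (le_abs_self _).trans ?_
    rw [abs_mul, abs_pow, abs_neg, abs_one, one_pow, one_mul]
    exact le_ciSup hb ((j : ℝ) * (π / m))
  rw [h1, Finset.sum_const, Finset.card_range, nsmul_eq_mul] at h2
  exact le_of_mul_le_mul_left h2 (by positivity)

theorem bestC_le_of_abs_le (m : ℕ) {g : ℝ → ℝ} {E : ℝ} (hE : 0 ≤ E) (h : ∀ x, |g x| ≤ E) :
    bestC m g ≤ E := by
  have hb : BddBelow (Set.range fun T : trigPoly m => normC fun x => g x - (T : ℝ → ℝ) x) :=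
    ⟨0, by rintro _ ⟨T, rfl⟩; exact Real.iSup_nonneg fun x => abs_nonneg _⟩
  refine (ciInf_le hb ⟨_, zero_mem_trigPoly m⟩).trans ?_
  exact Real.iSup_le (fun x => by simpa using h x) hE

/-- A continuous approximation to `E * sign (cos (m t))`. -/
noncomputable def clippedCos (E N : ℝ) (m : ℕ) (t : ℝ) : ℝ :=
  E * max (-1) (min 1 (N * Real.cos (m * t)))

theorem clippedCos_mem_spaceC (E N : ℝ) (m : ℕ) : clippedCos E N m ∈ spaceC := by
  constructor
  · intro t
    simp only [clippedCos, mul_add, Real.cos_add_nat_mul_two_pi]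
  · unfold clippedCos
    fun_prop

theorem abs_clippedCos_le {E : ℝ} (hE : 0 ≤ E) (N : ℝ) (m : ℕ) (t : ℝ) :
    |clippedCos E N m t| ≤ E := by
  rw [clippedCos, abs_mul, abs_of_nonneg hE]
  refine mul_le_of_le_one_right hE (abs_le.2 ⟨le_max_left _ _, ?_⟩)
  exact max_le (by norm_num) (min_le_left _ _)

theorem clip_neg (c : ℝ) : max (-1) (min 1 (-c)) = -max (-1) (min 1 c) := by
  rw [← min_neg_neg, ← max_neg_neg, neg_neg, max_min_distrib_left, max_eq_right (by norm_num)]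

theorem clippedCos_neg_arg {E N : ℝ} {m : ℕ} {s t : ℝ}
    (h : Real.cos (m * s) = -Real.cos (m * t)) : clippedCos E N m s = -clippedCos E N m t := by
  rw [clippedCos, clippedCos, h, mul_neg, clip_neg, mul_neg]

/-- Translation by `π / m` changes the sign of the function, so its mean vanishes. -/
theorem fourierA_clippedCos_zero (E N : ℝ) {m : ℕ} (hm : 1 ≤ m) :
    fourierA (clippedCos E N m) 0 = 0 := by
  have hm' : (m : ℝ) ≠ 0 := by positivity
  have h := integral_add_const_of_periodic (clippedCos_mem_spaceC E N m).1 (π / m)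
  have h1 : ∀ t, clippedCos E N m (t + π / m) = -clippedCos E N m t := fun t =>
    clippedCos_neg_arg (by rw [mul_add, mul_div_cancel₀ _ hm', Real.cos_add_pi])
  simp_rw [h1] at h
  rw [integral_neg] at h
  rw [fourierA]
  simp only [Nat.cast_zero, zero_mul, Real.cos_zero, mul_one]
  rw [show ∫ t in (-π)..π, clippedCos E N m t = 0 by linarith, mul_zero]

theorem clippedCos_node (E : ℝ) {N : ℝ} (hN : 1 ≤ N) {m : ℕ} (hm : 1 ≤ m) (j : ℕ) :
    clippedCos E N m (j * (π / m)) = (-1) ^ j * E := by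
  have hm' : (m : ℝ) ≠ 0 := by positivity
  have : Real.cos (m * (j * (π / m))) = (-1) ^ j := by
    rw [show (m : ℝ) * (j * (π / m)) = 0 + j * π by field_simp; ring, Real.cos_add_nat_mul_pi]
    simp
  rw [clippedCos, this]
  rcases neg_one_pow_eq_or ℝ j with h | h <;> rw [h]
  · rw [mul_one, min_eq_left hN, max_eq_right (by norm_num)]
    ring
  · rw [min_eq_right (by linarith), max_eq_left (by linarith)]
    ring

theorem bestC_clippedCos {E : ℝ} (hE : 0 ≤ E) {N : ℝ} (hN : 1 ≤ N) {m : ℕ} (hm : 1 ≤ m) :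
    bestC m (clippedCos E N m) = E :=
  le_antisymm (bestC_le_of_abs_le m hE (abs_clippedCos_le hE N m))
    (le_bestC_of_alternating hm (clippedCos_mem_spaceC E N m) (clippedCos_node E hN hm))

/-- Clipping `N c` gives the sign of `c` unless `|c| < 1/N`, so the loss against `|cos|`, whose
integral is 4, is at most `1/N` pointwise. -/
theorem le_fourierA_clippedCos {E : ℝ} (hE : 0 ≤ E) {N : ℝ} (hN : 1 ≤ N) {m : ℕ} (hm : 1 ≤ m) :
    (4 / π - 2 / N) * E ≤ fourierA (clippedCos E N m) m := by
  have hpi := Real.pi_pos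
  have hN0 : 0 < N := by linarith
  have key : ∀ c : ℝ, |c| - 1 / N ≤ max (-1) (min 1 (N * c)) * c := by
    intro c
    have hN1 : 0 < 1 / N := by positivity
    have e : N * (1 / N) = 1 := by field_simp
    have hpos : ∀ c : ℝ, 0 ≤ c → c - 1 / N ≤ max (-1) (min 1 (N * c)) * c := by
      intro c hc
      rcases le_total 1 (N * c) with h | h
      · rw [min_eq_left h, max_eq_right (by norm_num)]
        linarith
      · have hc0 : 0 ≤ N * c := by positivity
        rw [min_eq_right h, max_eq_right (by linarith)]
        have : c ≤ 1 / N := by rwa [le_div_iff₀' hN0]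
        nlinarith
    rcases le_total 0 c with hc | hc
    · rw [abs_of_nonneg hc]
      exact hpos c hc
    · rw [abs_of_nonpos hc]
      have h := hpos (-c) (by linarith)
      rw [mul_neg N, clip_neg] at h
      linarith
  have h1 : ∫ t in (-π)..π, E * (|Real.cos (m * (0 - t))| - 1 / N) ≤
      ∫ t in (-π)..π, clippedCos E N m t * Real.cos (m * t) := by
    refine integral_mono_on (by linarith) (Continuous.intervalIntegrable (by fun_prop) _ _)
      (Continuous.intervalIntegrable
        ((clippedCos_mem_spaceC E N m).2.mul (by fun_prop)) _ _) fun t _ => ?_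
    rw [clippedCos, mul_assoc, zero_sub, mul_neg, Real.cos_neg]
    exact mul_le_mul_of_nonneg_left (key _) hE
  rw [integral_const_mul, integral_sub (Continuous.intervalIntegrable (by fun_prop) _ _) (by simp),
    integral_abs_cos hm] at h1
  simp only [integral_const, smul_eq_mul] at h1
  rw [fourierA]
  calc _ = 1 / π * (E * (4 - (π - -π) * (1 / N))) := by field_simp; ring
    _ ≤ _ := by gcongr

/-! ### Constructing a function from its derivative -/

/-- The function whose Fourier series is
`∑_{k ≥ 1} ψ(k) (a_k(φ) cos (kx - β_k π/2) + b_k(φ) sin (kx - β_k π/2))`. -/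
noncomputable def psiBetaIntegral (ψ β : ℕ → ℝ) (φ : ℝ → ℝ) (x : ℝ) : ℝ :=
  ∑' k : ℕ, ψ (k + 1) * harmonic φ (k + 1) (x - β (k + 1) * π / (2 * (k + 1 : ℕ)))

theorem harmonic_sub (φ : ℝ → ℝ) (k : ℕ) (s x : ℝ) :
    harmonic φ k (x - s) =
      (fourierA φ k * Real.cos (k * s) - fourierB φ k * Real.sin (k * s)) * Real.cos (k * x) +
      (fourierA φ k * Real.sin (k * s) + fourierB φ k * Real.cos (k * s)) * Real.sin (k * x) := by
  rw [harmonic, mul_sub, Real.cos_sub, Real.sin_sub]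
  ring

theorem continuous_harmonic (φ : ℝ → ℝ) (k : ℕ) : Continuous (harmonic φ k) := by
  unfold harmonic
  fun_prop

theorem abs_harmonic_le_of_abs_le {φ : ℝ → ℝ} (hφ : φ ∈ spaceC) {M : ℝ} (hM : ∀ x, |φ x| ≤ M)
    (k : ℕ) (x : ℝ) : |harmonic φ k x| ≤ 2 * M :=
  abs_harmonic_le (hφ.2.intervalIntegrable _ _) (Nat.zero_le k) (zero_mem_trigPoly 0)
    (Filter.Eventually.of_forall fun t => by simpa using hM t) x

theorem abs_psiBetaIntegral_term_le {ψ : ℕ → ℝ} (hψ : IsD0 ψ) {φ : ℝ → ℝ} (hφ : φ ∈ spaceC)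
    {M : ℝ} (hM : ∀ x, |φ x| ≤ M) (k : ℕ) (x : ℝ) :
    |ψ (k + 1) * harmonic φ (k + 1) x| ≤ ψ (k + 1) * (2 * M) := by
  have hpos := hψ.1 (k + 1) (by omega)
  rw [abs_mul, abs_of_pos hpos]
  exact mul_le_mul_of_nonneg_left (abs_harmonic_le_of_abs_le hφ hM _ _) hpos.le

theorem psiBetaIntegral_mem_spaceC {ψ : ℕ → ℝ} (hψ : IsD0 ψ) (β : ℕ → ℝ) {φ : ℝ → ℝ}
    (hφ : φ ∈ spaceC) : psiBetaIntegral ψ β φ ∈ spaceC := by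
  obtain ⟨M, hM⟩ := exists_abs_le_of_mem_spaceC hφ
  constructor
  · intro x
    refine tsum_congr fun k => ?_
    congr 1
    simp only [harmonic, add_sub_right_comm, mul_add, Real.cos_add_nat_mul_two_pi,
      Real.sin_add_nat_mul_two_pi]
  · refine continuous_tsum (u := fun k => ψ (k + 1) * (2 * M)) (fun k => ?_)
      (hψ.summable_succ.mul_right _) fun k x => ?_
    · exact continuous_const.mul ((continuous_harmonic φ _).comp (by fun_prop))
    · exact abs_psiBetaIntegral_term_le hψ hφ hM k _

theorem hasSum_psiBetaIntegral {ψ : ℕ → ℝ} (hψ : IsD0 ψ) (β : ℕ → ℝ) {φ : ℝ → ℝ}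
    (hφ : φ ∈ spaceC) (x : ℝ) :
    HasSum (fun k => ψ (k + 1) * harmonic φ (k + 1) (x - β (k + 1) * π / (2 * (k + 1 : ℕ))))
      (psiBetaIntegral ψ β φ x) := by
  obtain ⟨M, hM⟩ := exists_abs_le_of_mem_spaceC hφ
  exact (Summable.of_norm_bounded (hψ.summable_succ.mul_right (2 * M)) fun k =>
    abs_psiBetaIntegral_term_le hψ hφ hM k _).hasSum

theorem integral_harmonic_sub_mul_cos {φ : ℝ → ℝ} {j : ℕ} (hj : 1 ≤ j) (k : ℕ) (s x : ℝ) :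
    ∫ t in (-π)..π, harmonic φ k (t - s) * Real.cos (j * (x - t)) =
      if k = j then π * harmonic φ j (x - s) else 0 := by
  simp only [harmonic_sub]
  split_ifs with hk
  · subst hk
    exact integral_harmonic_mul_cos hj _ _ _
  · exact integral_harmonic_mul_cos_of_ne hk _ _ _

/-- Summability of `ψ` dominates the series, so it may be integrated termwise; orthogonality leaves
one term. -/
theorem harmonic_psiBetaIntegral {ψ : ℕ → ℝ} (hψ : IsD0 ψ) (β : ℕ → ℝ) {φ : ℝ → ℝ}
    (hφ : φ ∈ spaceC) {j : ℕ} (hj : 1 ≤ j) (x : ℝ) :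
    harmonic (psiBetaIntegral ψ β φ) j x = ψ j * harmonic φ j (x - β j * π / (2 * j)) := by
  obtain ⟨M, hM⟩ := exists_abs_le_of_mem_spaceC hφ
  have hF := psiBetaIntegral_mem_spaceC hψ β hφ
  rw [harmonic_eq_integral (hF.2.intervalIntegrable _ _)]
  have h : HasSum (fun k => ∫ t in (-π)..π, ψ (k + 1) *
      harmonic φ (k + 1) (t - β (k + 1) * π / (2 * (k + 1 : ℕ))) * Real.cos (j * (x - t)))
      (∫ t in (-π)..π, psiBetaIntegral ψ β φ t * Real.cos (j * (x - t))) := by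
    refine hasSum_integral_of_dominated_convergence (fun k _ => ψ (k + 1) * (2 * M))
      (fun k => Continuous.aestronglyMeasurable ?_)
      (fun k => Filter.Eventually.of_forall fun t _ => ?_)
      (Filter.Eventually.of_forall fun t _ => hψ.summable_succ.mul_right _) (by simp)
      (Filter.Eventually.of_forall fun t _ => (hasSum_psiBetaIntegral hψ β hφ t).mul_right _)
    · exact (continuous_const.mul ((continuous_harmonic φ _).comp (by fun_prop))).mul
        (by fun_prop)
    · rw [Real.norm_eq_abs, abs_mul]
      exact (mul_le_of_le_one_right (abs_nonneg _) (Real.abs_cos_le_one _)).trans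
        (abs_psiBetaIntegral_term_le hψ hφ hM k _)
  have hterm : ∀ k, ∫ t in (-π)..π, ψ (k + 1) *
      harmonic φ (k + 1) (t - β (k + 1) * π / (2 * (k + 1 : ℕ))) * Real.cos (j * (x - t)) =
      if k = j - 1 then π * (ψ j * harmonic φ j (x - β j * π / (2 * j))) else 0 := by
    intro k
    simp_rw [mul_assoc (ψ (k + 1))]
    rw [integral_const_mul, integral_harmonic_sub_mul_cos hj]
    by_cases hk : k = j - 1
    · obtain rfl : j = k + 1 := by omega
      rw [if_pos rfl, if_pos hk]
      ring
    · rw [if_neg (by omega), if_neg hk, mul_zero]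
  simp_rw [hterm] at h
  rw [← h.tsum_eq, tsum_ite_eq]
  field_simp

theorem isPsiBetaDeriv_psiBetaIntegral {ψ : ℕ → ℝ} (hψ : IsD0 ψ) (β : ℕ → ℝ) {φ : ℝ → ℝ}
    (hφ : φ ∈ spaceC) (h0 : fourierA φ 0 = 0) :
    IsPsiBetaDeriv ψ β (psiBetaIntegral ψ β φ) φ := by
  refine ⟨spaceC_subset_spaceL_one (psiBetaIntegral_mem_spaceC hψ β hφ),
    spaceC_subset_spaceL_one hφ, h0, fun k hk x => ?_⟩
  have hk' : (k : ℝ) ≠ 0 := by positivity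
  have hpos := hψ.1 k hk
  have h := harmonic_psiBetaIntegral hψ β hφ hk (x + β k * π / (2 * k))
  rw [add_sub_cancel_right, harmonic, harmonic,
    show (k : ℝ) * (x + β k * π / (2 * k)) = k * x + β k * π / 2 by field_simp] at h
  rw [h]
  field_simp

/-! ### The lower estimate and the choice of `θ` -/

theorem harmonic_add_pi (f : ℝ → ℝ) (k : ℕ) (x : ℝ) :
    harmonic f k (x + π) = (-1) ^ k * harmonic f k x := by
  rw [harmonic, harmonic, cos_nat_mul_add_pi, sin_nat_mul_add_pi]
  ring

/-- At `x₀` the shift is undone and the leading harmonic equals `ψ (q + 1) * fourierA φ (q + 1)`. At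
`x₀` and `x₀ + π` the second harmonic enters with opposite relative signs, so averaging the two
bounds cancels it. -/
theorem le_normC_rho {ψ β : ℕ → ℝ} (hψ : IsD0 ψ) {f φ : ℝ → ℝ} (hf : f ∈ spaceC)
    (h : IsPsiBetaDeriv ψ β f φ) {q p : ℕ} (hp : 1 ≤ p) {M : ℝ} (hM : ∀ x, |φ x| ≤ M) :
    ψ (q + 1) * fourierA φ (q + 1) - 2 * M * tailSum ψ q p ≤
      p * normC (rho (q + p) p f) := by
  have hM' : ∀ᵐ t ∂periodMeasure, |φ t - (fun _ => (0 : ℝ)) t| ≤ M :=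
    Filter.Eventually.of_forall fun t => by simpa using hM t
  have hT := zero_mem_trigPoly (q + 1)
  have hb : BddAbove (Set.range fun x => |rho (q + p) p f x|) :=
    ⟨_, by rintro _ ⟨x, rfl⟩; exact abs_rho_le hψ hf h hp hT hM' x⟩
  set x₀ := β (q + 1) * π / (2 * (q + 1 : ℕ)) with hx₀
  have e : ψ (q + 1) * fourierA φ (q + 1) = harmonic f (q + 1) x₀ := by
    rw [h.harmonic_eq (by omega) (hψ.1 _ (by omega)), sub_self]
    simp [harmonic]
  have key : ∀ x, |harmonic f (q + 1) x + (min 2 p : ℕ) * harmonic f (q + 2) x| ≤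
      p * normC (rho (q + p) p f) + 2 * M * tailSum ψ q p := by
    intro x
    have h1 := abs_rho_sub_le hψ hf h hp hT hM' x
    have h2 : |rho (q + p) p f x| ≤ normC (rho (q + p) p f) := le_ciSup hb x
    have h3 := mul_le_mul_of_nonneg_left h2 (Nat.cast_nonneg (α := ℝ) p)
    rw [← abs_of_nonneg (Nat.cast_nonneg (α := ℝ) p), ← abs_mul,
      abs_of_nonneg (Nat.cast_nonneg (α := ℝ) p)] at h3
    rw [abs_sub_comm] at h1
    linarith [abs_sub_abs_le_abs_sub
      (harmonic f (q + 1) x + (min 2 p : ℕ) * harmonic f (q + 2) x) (p * rho (q + p) p f x)]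
  have h1 := key x₀
  have h2 := key (x₀ + π)
  rw [harmonic_add_pi, harmonic_add_pi,
    show (-1) ^ (q + 1) * harmonic f (q + 1) x₀ +
      (min 2 p : ℕ) * ((-1) ^ (q + 2) * harmonic f (q + 2) x₀) =
      (-1) ^ (q + 1) * (harmonic f (q + 1) x₀ - (min 2 p : ℕ) * harmonic f (q + 2) x₀) by ring,
    abs_mul, abs_pow, abs_neg, abs_one, one_pow, one_mul] at h2
  rw [e]
  linarith [le_abs_self (harmonic f (q + 1) x₀ + (min 2 p : ℕ) * harmonic f (q + 2) x₀),
    le_abs_self (harmonic f (q + 1) x₀ - (min 2 p : ℕ) * harmonic f (q + 2) x₀)]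

theorem ae_abs_sub_le_normL {φ T : ℝ → ℝ} (hφ : φ ∈ spaceL ∞) {m : ℕ} (hT : T ∈ trigPoly m) :
    ∀ᵐ t ∂periodMeasure, |φ t - T t| ≤ normL ∞ fun x => φ x - T x := by
  have hTc := continuous_of_mem_trigPoly hT
  obtain ⟨M, hM⟩ := exists_abs_le_of_mem_spaceC ⟨periodic_of_mem_trigPoly hT, hTc⟩
  have hfin : MeasureTheory.eLpNorm (fun x => φ x - T x) ∞ periodMeasure ≠ ∞ :=
    (hφ.2.sub (MeasureTheory.memLp_top_of_bound hTc.aestronglyMeasurable M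
      (Filter.Eventually.of_forall hM))).2.ne
  rw [MeasureTheory.eLpNorm_exponent_top] at hfin
  filter_upwards [MeasureTheory.ae_le_eLpNormEssSup (f := fun x => φ x - T x)
    (μ := periodMeasure)] with t ht
  rw [normL, MeasureTheory.eLpNorm_exponent_top]
  have := ENNReal.toReal_mono hfin ht
  rwa [toReal_enorm] at this

theorem remainder_pos {ψ : ℕ → ℝ} (hψ : IsD0 ψ) {q p : ℕ} (hp : 1 ≤ p) :
    0 < remainder ψ (q + p) p := by
  rw [remainder_add_eq]
  have h1 := hψ.1 (q + 1) (by omega)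
  have h2 := hψ.1 (q + 2) (by omega)
  have := tailSum_nonneg hψ (q := q) hp
  positivity

theorem normC_rho_le {ψ β : ℕ → ℝ} (hψ : IsD0 ψ) {f φ : ℝ → ℝ} (hf : f ∈ spaceC)
    (h : IsPsiBetaDeriv ψ β f φ) (hφ : φ ∈ spaceL ∞) {q p : ℕ} (hp : 1 ≤ p) :
    normC (rho (q + p) p f) ≤
      1 / (p : ℝ) * (4 / π * ψ (q + 1) + 8 * remainder ψ (q + p) p) * bestL ∞ (q + 1) φ := by
  have : Nonempty (trigPoly (q + 1)) := ⟨⟨_, zero_mem_trigPoly _⟩⟩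
  have hR := remainder_pos hψ (q := q) hp
  have hψ1 := hψ.1 (q + 1) (by omega)
  have hpi := Real.pi_pos
  rw [bestL, Real.mul_iInf_of_nonneg (by positivity)]
  exact le_ciInf fun T => ciSup_le fun x =>
    abs_rho_le hψ hf h hp T.2 (ae_abs_sub_le_normL hφ T.2) x

theorem exists_normC_rho_eq {ψ : ℕ → ℝ} (hψ : IsD0 ψ) (β : ℕ → ℝ) {q p : ℕ} (hp : 1 ≤ p)
    {E : ℝ} (hE : 0 ≤ E) :
    ∃ F ∈ classC ψ β spaceC, ∃ Φ ∈ spaceC, IsPsiBetaDeriv ψ β F Φ ∧ bestC (q + 1) Φ = E ∧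
      ∃ θ : ℝ, |θ| ≤ 8 ∧ normC (rho (q + p) p F) =
        1 / (p : ℝ) * (4 / π * ψ (q + 1) + θ * remainder ψ (q + p) p) * bestC (q + 1) Φ := by
  have hpi := Real.pi_pos
  have hp' : (0 : ℝ) < p := by positivity
  have ha := hψ.1 (q + 1) (by omega)
  have hb := hψ.1 (q + 2) (by omega)
  have hR := remainder_pos hψ (q := q) hp
  have htail := tailSum_nonneg hψ (q := q) hp
  -- With `a = ψ (q + 1)` and `b = ψ (q + 2)`, this steepness makes the clipping loss `2a/N` at most
  -- `b²/a`, the first term of the remainder.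
  set N : ℝ := 1 + 2 * ψ (q + 1) ^ 2 / ψ (q + 2) ^ 2 with hN
  have hN1 : 1 ≤ N := by
    have : 0 ≤ 2 * ψ (q + 1) ^ 2 / ψ (q + 2) ^ 2 := by positivity
    linarith
  set Φ := clippedCos E N (q + 1)
  have hΦ : Φ ∈ spaceC := clippedCos_mem_spaceC _ _ _
  have hΦE : ∀ x, |Φ x| ≤ E := abs_clippedCos_le hE _ _
  set F := psiBetaIntegral ψ β Φ
  have hF : F ∈ spaceC := psiBetaIntegral_mem_spaceC hψ β hΦ
  have hd : IsPsiBetaDeriv ψ β F Φ :=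
    isPsiBetaDeriv_psiBetaIntegral hψ β hΦ (fourierA_clippedCos_zero E N (by omega))
  have hbest : bestC (q + 1) Φ = E := bestC_clippedCos hE hN1 (by omega)
  refine ⟨F, ⟨hF, Φ, hΦ, hd⟩, Φ, hΦ, hd, hbest, ?_⟩
  rw [hbest]
  have hupper : normC (rho (q + p) p F) ≤
      1 / (p : ℝ) * (4 / π * ψ (q + 1) + 8 * remainder ψ (q + p) p) * E :=
    ciSup_le fun x => abs_rho_le hψ hF hd hp (zero_mem_trigPoly _)
      (Filter.Eventually.of_forall fun t => by simpa using hΦE t) x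
  have hlower : (4 / π * ψ (q + 1) - 8 * remainder ψ (q + p) p) * E ≤
      p * normC (rho (q + p) p F) := by
    refine le_trans ?_ (le_normC_rho hψ hF hd hp hΦE)
    have h1 := mul_le_mul_of_nonneg_left
      (le_fourierA_clippedCos hE hN1 (m := q + 1) (by omega)) ha.le
    have h2 : ψ (q + 1) * (2 / N) ≤ ψ (q + 2) ^ 2 / ψ (q + 1) := by
      rw [mul_div_assoc', div_le_div_iff₀ (by linarith) ha, hN, mul_add, mul_div_cancel₀ _
        (by positivity)]
      nlinarith [sq_nonneg (ψ (q + 2))]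
    have h3 : ψ (q + 1) * (2 / N) * E ≤ ψ (q + 2) ^ 2 / ψ (q + 1) * E := by gcongr
    have h4 : 0 ≤ ψ (q + 2) ^ 2 / ψ (q + 1) * E := by positivity
    have h5 := mul_nonneg htail hE
    rw [remainder_add_eq]
    nlinarith
  -- For `E = 0` both sides vanish and any `θ` serves; otherwise the equation determines `θ`, and
  -- the two estimates give `|θ| ≤ 8`.
  rcases hE.eq_or_lt with rfl | hE0
  · refine ⟨0, by norm_num, ?_⟩
    rw [mul_zero] at hupper ⊢
    exact le_antisymm hupper (Real.iSup_nonneg fun x => abs_nonneg _)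
  · set ν := normC (rho (q + p) p F)
    refine ⟨(p * ν / E - 4 / π * ψ (q + 1)) / remainder ψ (q + p) p, ?_, ?_⟩
    · have hu : p * ν / E ≤ 4 / π * ψ (q + 1) + 8 * remainder ψ (q + p) p := by
        rw [div_le_iff₀ hE0]
        calc p * ν ≤ p * (1 / (p : ℝ) * (4 / π * ψ (q + 1) + 8 * remainder ψ (q + p) p) * E) := by
              gcongr
          _ = _ := by field_simp
      have hl : 4 / π * ψ (q + 1) - 8 * remainder ψ (q + p) p ≤ p * ν / E := by
        rwa [le_div_iff₀ hE0]
      rw [abs_div, abs_of_pos hR, div_le_iff₀ hR, abs_le]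
      constructor <;> linarith
    · rw [div_mul_cancel₀ _ hR.ne']
      field_simp
      ring

end VP

theorem mainTheorem2 :
    ∃ K : ℝ, ∀ ψ β : ℕ → ℝ, VP.IsD0 ψ →
      ∀ n p : ℕ, 1 ≤ p → p ≤ n →
        ∀ f ∈ VP.classC ψ β (VP.spaceL ∞),
          ∀ φ ∈ VP.spaceL ∞, VP.IsPsiBetaDeriv ψ β f φ →
            VP.normC (VP.rho n p f) ≤
                (1 / (p : ℝ)) * (4 / π * ψ (n - p + 1) + K * VP.remainder ψ n p) *
                  VP.bestL ∞ (n - p + 1) φ ∧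
            ∃ F ∈ VP.classC ψ β VP.spaceC,
              ∃ Φ ∈ VP.spaceC, VP.IsPsiBetaDeriv ψ β F Φ ∧
                VP.bestC (n - p + 1) Φ = VP.bestL ∞ (n - p + 1) φ ∧
                ∃ θ : ℝ, |θ| ≤ K ∧
                  VP.normC (VP.rho n p F) =
                    (1 / (p : ℝ)) * (4 / π * ψ (n - p + 1) + θ * VP.remainder ψ n p) *
                      VP.bestC (n - p + 1) Φ := by
  refine ⟨8, fun ψ β hψ n p hp hpn f hf φ hφ h => ?_⟩
  -- Writing `n = q + p` eliminates truncated subtraction.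
  obtain ⟨q, rfl⟩ : ∃ q, n = q + p := ⟨n - p, by omega⟩
  rw [Nat.add_sub_cancel]
  exact ⟨VP.normC_rho_le hψ hf.1 h hφ hp, VP.exists_normC_rho_eq hψ β hp
    (Real.iInf_nonneg fun _ => ENNReal.toReal_nonneg)⟩
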